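/- Let $\mathbb{D}=\{z\in\mathbb{C}:|z|<1\}$ and $\mathbb{T}=\{z\in\mathbb{C}:|z|=1\}$. For a bounded linear operator $T$ on a Hilbert space $X$, a vector $x$ is hypercyclic for $T$ if $\{T^n x:n\ge 0\}$ is dense in $X$; a hypercyclic subspace for $T$ is an infinite-dimensional closed subspace of $X$ in which every non-zero vector is hypercyclic for $T$. Let $\phi$ be a non-constant function in the disc algebra, i.e. continuous on $\overline{\mathbb{D}}$ and holomorphic in $\mathbb{D}$, such that $\phi(\mathbb{T})\cap\mathbb{T}\neq\emptyset$ and $\phi(\mathbb{D})\cap\mathbb{T}\neq\emptyset$. Let $S^*(x_0,x_1,x_2,\dots)=(x_1,x_2,x_3,\dots)$ be the backward shift on $\ell^2(\mathbb{N}_0)$, and let $\phi(S^*)$ be the limit in operator norm of $P_n(S^*)$, where $P_n$ are any polynomials converging to $\phi$ uniformly on $\overline{\mathbb{D}}$. Then $\phi(S^*)$ has a hypercyclic subspace. Moreover, let $H^2\subset L^2(\mathbb{T})$ be the Hardy space of functions whose Fourier coefficients of negative index vanish, let $P_+$ be the orthogonal projection of $L^2(\mathbb{T})$ onto $H^2$,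 and let $T_{\overline{\phi}}f=P_+(\overline{\phi}f)$ be the coanalytic Toeplitz operator on $H^2$ with symbol $\overline{\phi}|_{\mathbb{T}}$. Then $T_{\overline{\phi}}$ has a hypercyclic subspace. -/

import Mathlib

open Filter Topology Metric MeasureTheory Polynomial
open scoped ENNReal lp ComplexConjugate

noncomputable section

namespace HypSub

/-! ### Hypercyclic vectors and hypercyclic subspaces -/

section Hypercyclic

variable {X : Type*} [NormedAddCommGroup X] [NormedSpace ℂ X]

/-- `x` is a hypercyclic vector for `T`: the orbit `{T ^ n x : n ≥ 0}` is dense. -/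
def IsHypercyclicVector (T : X →L[ℂ] X) (x : X) : Prop :=
  Dense (Set.range fun n : ℕ => (T ^ n) x)

/-- `M` is a hypercyclic subspace for `T`: an infinite-dimensional closed subspace in which
every non-zero vector is hypercyclic for `T`. -/
def IsHypercyclicSubspace (T : X →L[ℂ] X) (M : Submodule ℂ X) : Prop :=
  IsClosed (M : Set X) ∧ ¬ FiniteDimensional ℂ M ∧
    ∀ x ∈ M, x ≠ 0 → IsHypercyclicVector T x

/-- `T` has a hypercyclic subspace. -/
def HasHypercyclicSubspace (T : X →L[ℂ] X) : Prop :=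
  ∃ M : Submodule ℂ X, IsHypercyclicSubspace T M

end Hypercyclic

/-! ### The backward shift on `ℓ²(ℕ₀)` -/

/-- The space `ℓ²` over an index type. -/
abbrev Ell2 (ι : Type) : Type := lp (fun _ : ι => ℂ) 2

theorem memlp_comp {ι κ : Type} (e : ι → κ) (he : Function.Injective e) (x : Ell2 κ) :
    Memℓp (fun i => x (e i)) 2 := by
  have h := (lp.memℓp x).summable (by norm_num)
  exact memℓp_gen (h.comp_injective he)

/-- Composition with an injective map of index sets, a contraction of `ℓ²` spaces:
`(x_k)_k ↦ (x_{e(i)})_i`. -/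
def pullback {ι κ : Type} (e : ι → κ) (he : Function.Injective e) : Ell2 κ →L[ℂ] Ell2 ι :=
  LinearMap.mkContinuous
    { toFun := fun x => ⟨fun i => x (e i), memlp_comp e he x⟩
      map_add' := fun _ _ => rfl
      map_smul' := fun _ _ => rfl } 1 (by
    intro x
    rw [one_mul]
    refine lp.norm_le_of_forall_sum_le (by norm_num) (norm_nonneg _) fun s => ?_
    have := lp.sum_rpow_le_norm_rpow (p := 2) (by norm_num) x (s.map ⟨e, he⟩)
    rw [Finset.sum_map] at this
    exact this)

@[simp] theorem pullback_apply {ι κ : Type} (e : ι → κ) (he : Function.Injective e)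
    (x : Ell2 κ) (i : ι) : pullback e he x i = x (e i) := rfl

theorem norm_pullback_le {ι κ : Type} (e : ι → κ) (he : Function.Injective e) (x : Ell2 κ) :
    ‖pullback e he x‖ ≤ ‖x‖ := by
  have := (pullback e he).le_of_opNorm_le (LinearMap.mkContinuous_norm_le _ zero_le_one _) x
  simpa using this

/-- The backward shift `S* : (x₀, x₁, x₂, …) ↦ (x₁, x₂, x₃, …)` on `ℓ²(ℕ₀)`. -/
def backwardShift : Ell2 ℕ →L[ℂ] Ell2 ℕ :=
  pullback (fun n => n + 1) (add_left_injective 1)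

theorem backwardShift_apply (x : Ell2 ℕ) (n : ℕ) : backwardShift x n = x (n + 1) := rfl

/-! ### The operator `φ(S*)` for `φ` in the disc algebra

The disc algebra consists of the functions continuous on the closed unit disc and holomorphic in
the open unit disc, i.e. those satisfying `DiffContOnCl ℂ φ (ball 0 1)`. -/

/-- The bilateral shift on `ℓ²(ℤ)`. -/
def bilateralShift : Ell2 ℤ ≃ₗᵢ[ℂ] Ell2 ℤ where
  toFun := pullback (fun n => n + 1) (add_left_injective 1)
  invFun := pullback (fun n => n - 1) (sub_left_injective (b := 1))
  map_add' := map_add _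
  map_smul' := map_smul _
  left_inv x := by ext n; simp
  right_inv x := by ext n; simp
  norm_map' x := by
    refine le_antisymm (norm_pullback_le (fun n : ℤ => n + 1) (add_left_injective 1) x) ?_
    have h : x = pullback (fun n : ℤ => n - 1) (sub_left_injective (b := 1))
        (pullback (fun n => n + 1) (add_left_injective 1) x) := by ext n; simp
    conv_lhs => rw [h]
    exact norm_pullback_le _ _ _

theorem norm_aeval_bilateralShift_le (P : ℂ[X]) {M : ℝ}
    (hM : ∀ z ∈ closedBall (0 : ℂ) 1, ‖P.eval z‖ ≤ M) :
    ‖aeval (bilateralShift.toContinuousLinearEquiv : Ell2 ℤ →L[ℂ] Ell2 ℤ) P‖ ≤ M := by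
  have hu : (bilateralShift.toContinuousLinearEquiv : Ell2 ℤ →L[ℂ] Ell2 ℤ) ∈ unitary (Ell2 ℤ →L[ℂ] Ell2 ℤ) := by
    have := (Unitary.linearIsometryEquiv.symm bilateralShift).2
    rwa [Unitary.coe_symm_linearIsometryEquiv_apply] at this
  set U : Ell2 ℤ →L[ℂ] Ell2 ℤ :=
    (bilateralShift.toContinuousLinearEquiv : Ell2 ℤ →L[ℂ] Ell2 ℤ)
  have hn : IsStarNormal U := (unitary_iff_isStarNormal_and_spectrum_subset_unitary.mp hu).1
  rw [← cfc_polynomial P U hn]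
  refine norm_cfc_le ((norm_nonneg _).trans (hM 0 (by simp))) fun z hz => hM z ?_
  exact sphere_subset_closedBall (spectrum.subset_circle_of_unitary hu hz)

/-- Von Neumann's inequality for the backward shift. -/
theorem norm_aeval_backwardShift_le (P : ℂ[X]) {M : ℝ}
    (hM : ∀ z ∈ closedBall (0 : ℂ) 1, ‖P.eval z‖ ≤ M) :
    ‖aeval backwardShift P‖ ≤ M := by
  have hM0 : 0 ≤ M := (norm_nonneg _).trans (hM 0 (by simp))
  set U : Ell2 ℤ →L[ℂ] Ell2 ℤ :=
    (bilateralShift.toContinuousLinearEquiv : Ell2 ℤ →L[ℂ] Ell2 ℤ) with hU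
  let R : Ell2 ℤ →L[ℂ] Ell2 ℕ := pullback (fun n : ℕ => (n : ℤ)) Nat.cast_injective
  have hRU : ∀ y, backwardShift (R y) = R (U y) := by
    intro y
    ext n
    change y ((n + 1 : ℕ) : ℤ) = y ((n : ℤ) + 1)
    norm_cast
  have hpow : ∀ (n : ℕ) (y), (backwardShift ^ n) (R y) = R ((U ^ n) y) := by
    intro n
    induction n with
    | zero => intro y; rfl
    | succ k ih =>
      intro y
      rw [pow_succ, pow_succ, mul_apply_eq_comp, hRU, ih]
      rfl
  have hP : ∀ y, aeval backwardShift P (R y) = R (aeval U P y) := by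
    intro y
    rw [aeval_eq_sum_range, aeval_eq_sum_range]
    simp [hpow]
  refine ContinuousLinearMap.opNorm_le_bound _ hM0 fun x => ?_
  have hmem : Memℓp (Function.extend (fun n : ℕ => (n : ℤ)) x 0 : ℤ → ℂ) 2 := by
    refine memℓp_gen ?_
    have h := (lp.memℓp x).summable (by norm_num)
    rw [← Function.Injective.summable_iff (g := fun n : ℕ => (n : ℤ))
      Nat.cast_injective]
    · simpa [Function.comp_def, Nat.cast_injective.extend_apply] using h
    · intro n hn
      rw [Function.extend_apply' _ _ _ (fun h => hn h)]
      simp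
  let y : Ell2 ℤ := ⟨_, hmem⟩
  have hRy : R y = x := by
    ext n
    exact Nat.cast_injective.extend_apply _ _ _
  have hy : ‖y‖ ≤ ‖x‖ := by
    refine lp.norm_le_of_tsum_le (by norm_num) (norm_nonneg _) ?_
    rw [lp.norm_rpow_eq_tsum (by norm_num)]
    refine le_of_eq ?_
    rw [← Function.Injective.tsum_eq (g := fun n : ℕ => (n : ℤ)) Nat.cast_injective]
    · refine tsum_congr fun n => ?_
      change ‖Function.extend (fun n : ℕ => (n : ℤ)) x 0 (n : ℤ)‖ ^ _ = _
      rw [Nat.cast_injective.extend_apply]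
    · intro n hn
      by_contra hcon
      apply hn
      change ‖Function.extend (fun n : ℕ => (n : ℤ)) x 0 n‖ ^ _ = _
      rw [Function.extend_apply' _ _ _ (fun h => hcon h)]
      simp
  calc ‖aeval backwardShift P x‖ = ‖R (aeval U P y)‖ := by rw [← hP, hRy]
    _ ≤ ‖aeval U P y‖ := norm_pullback_le _ _ _
    _ ≤ ‖aeval U P‖ * ‖y‖ := ContinuousLinearMap.le_opNorm _ _
    _ ≤ M * ‖x‖ := by
        gcongr
        exact norm_aeval_bilateralShift_le P hM

/-- Polynomials are dense in the disc algebra. -/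
theorem exists_polynomial_approx {φ : ℂ → ℂ} (hφ : DiffContOnCl ℂ φ (ball 0 1)) {ε : ℝ}
    (hε : 0 < ε) : ∃ P : ℂ[X], ∀ z ∈ closedBall (0 : ℂ) 1, ‖P.eval z - φ z‖ < ε := by
  have hc : ContinuousOn φ (closedBall 0 1) := hφ.continuousOn_ball
  have huc : UniformContinuousOn φ (closedBall 0 1) :=
    (isCompact_closedBall 0 1).uniformContinuousOn_of_continuous hc
  obtain ⟨δ, hδ, h⟩ := Metric.uniformContinuousOn_iff.mp huc (ε / 2) (half_pos hε)
  obtain ⟨r, hr0, hr1, hrδ⟩ : ∃ r : ℝ, 0 < r ∧ r < 1 ∧ 1 - r < δ := by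
    refine ⟨max (1 / 2) (1 - δ / 2), by positivity, ?_, ?_⟩
    · rw [max_lt_iff]; constructor <;> linarith
    · linarith [le_max_right (1 / 2) (1 - δ / 2)]
  have hps := DiffContOnCl.hasFPowerSeriesOnBall (R := 1) (f := φ) (c := 0)
    (by simpa using hφ) one_pos
  obtain ⟨s, hrs, hs1⟩ := exists_between hr1
  have hu := hps.tendstoUniformlyOn (r' := ⟨s, (hr0.trans hrs).le⟩) (by
    exact ENNReal.coe_lt_coe.mpr hs1)
  obtain ⟨n, hn⟩ := (Metric.tendstoUniformlyOn_iff.mp hu (ε / 2) (half_pos hε)).exists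
  refine ⟨∑ k ∈ Finset.range n,
    Polynomial.monomial k ((cauchyPowerSeries φ 0 1).coeff k * (r : ℂ) ^ k), fun z hz => ?_⟩
  have hz1 : ‖z‖ ≤ 1 := by simpa using hz
  have hrz : ‖(r : ℂ) * z‖ ≤ r := by
    rw [norm_mul, Complex.norm_real, Real.norm_of_nonneg hr0.le]
    exact mul_le_of_le_one_right hr0.le hz1
  have h1 := hn ((r : ℂ) * z) (by
    rw [mem_ball_zero_iff]; exact hrz.trans_lt hrs)
  have h2 := h ((r : ℂ) * z) (by rw [mem_closedBall_zero_iff]; linarith) z hz (by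
    rw [dist_eq_norm, show (r : ℂ) * z - z = ((r - 1 : ℝ) : ℂ) * z by push_cast; ring, norm_mul,
      Complex.norm_real, Real.norm_eq_abs, abs_of_nonpos (by linarith)]
    nlinarith [norm_nonneg z])
  have hev : (∑ k ∈ Finset.range n,
      Polynomial.monomial k ((cauchyPowerSeries φ 0 1).coeff k * (r : ℂ) ^ k)).eval z =
      (cauchyPowerSeries φ 0 1).partialSum n ((r : ℂ) * z) := by
    rw [FormalMultilinearSeries.partialSum, Polynomial.eval_finsetSum]
    refine Finset.sum_congr rfl fun k _ => ?_
    rw [FormalMultilinearSeries.apply_eq_pow_smul_coeff, Polynomial.eval_monomial, smul_eq_mul,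
      mul_pow]
    ring
  rw [hev, ← dist_eq_norm]
  rw [zero_add, dist_comm] at h1
  calc _ ≤ _ := dist_triangle _ (φ (r * z)) _
    _ < ε / 2 + ε / 2 := by
      refine add_lt_add ?_ h2
      exact_mod_cast h1
    _ = ε := add_halves ε

/-- For `φ` in the disc algebra there is a sequence of polynomials converging to `φ` uniformly on
the closed unit disc. -/
theorem exists_polynomial_seq {φ : ℂ → ℂ} (hφ : DiffContOnCl ℂ φ (ball 0 1)) :
    ∃ P : ℕ → ℂ[X],
      TendstoUniformlyOn (fun n z => (P n).eval z) φ atTop (closedBall 0 1) := by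
  choose P hP using fun n : ℕ =>
    exists_polynomial_approx hφ (ε := 1 / ((n : ℝ) + 1)) (by positivity)
  refine ⟨P, Metric.tendstoUniformlyOn_iff.mpr fun ε hε => ?_⟩
  filter_upwards [tendsto_one_div_add_atTop_nhds_zero_nat.eventually (gt_mem_nhds hε)]
    with n hn z hz
  rw [dist_comm, dist_eq_norm]
  exact (hP n z hz).trans hn

/-- For `φ` in the disc algebra there is exactly one bounded operator `A` on `ℓ²(ℕ₀)` with
`Pₙ(S*) → A` in operator norm whenever the polynomials `Pₙ` converge to `φ` uniformly on the
closed unit disc. -/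
theorem existsUnique_discCalculus {φ : ℂ → ℂ} (hφ : DiffContOnCl ℂ φ (ball 0 1)) :
    ∃! A : Ell2 ℕ →L[ℂ] Ell2 ℕ, ∀ P : ℕ → ℂ[X],
      TendstoUniformlyOn (fun n z => (P n).eval z) φ atTop (closedBall 0 1) →
        Tendsto (fun n => aeval backwardShift (P n)) atTop (𝓝 A) := by
  obtain ⟨Q, hQ⟩ := exists_polynomial_seq hφ
  have key : ∀ P R : ℕ → ℂ[X],
      TendstoUniformlyOn (fun n z => (P n).eval z) φ atTop (closedBall 0 1) →
      TendstoUniformlyOn (fun n z => (R n).eval z) φ atTop (closedBall 0 1) →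
      ∀ ε > 0, ∃ N, ∀ m ≥ N, ∀ n ≥ N,
        ‖aeval backwardShift (P m) - aeval backwardShift (R n)‖ ≤ ε := by
    intro P R hP hR ε hε
    obtain ⟨N₁, h₁⟩ := eventually_atTop.mp
      (Metric.tendstoUniformlyOn_iff.mp hP (ε / 2) (half_pos hε))
    obtain ⟨N₂, h₂⟩ := eventually_atTop.mp
      (Metric.tendstoUniformlyOn_iff.mp hR (ε / 2) (half_pos hε))
    refine ⟨max N₁ N₂, fun m hm n hn => ?_⟩
    rw [← map_sub]
    refine norm_aeval_backwardShift_le _ fun z hz => ?_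
    rw [Polynomial.eval_sub, ← dist_eq_norm]
    have a := h₁ m (le_of_max_le_left hm) z hz
    have b := h₂ n (le_of_max_le_right hn) z hz
    have c := dist_triangle_left ((P m).eval z) ((R n).eval z) (φ z)
    linarith
  have hcauchy : CauchySeq fun n => aeval backwardShift (Q n) := by
    refine Metric.cauchySeq_iff.mpr fun ε hε => ?_
    obtain ⟨N, hN⟩ := key Q Q hQ hQ (ε / 2) (half_pos hε)
    exact ⟨N, fun m hm n hn => by
      rw [dist_eq_norm]; exact (hN m hm n hn).trans_lt (half_lt_self hε)⟩
  obtain ⟨A, hA⟩ := cauchySeq_tendsto_of_complete hcauchy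
  refine ⟨A, fun P hP => ?_, fun B hB => tendsto_nhds_unique (hB Q hQ) hA⟩
  have hdiff : Tendsto (fun n => aeval backwardShift (P n) - aeval backwardShift (Q n)) atTop
      (𝓝 0) := by
    refine Metric.tendsto_atTop.mpr fun ε hε => ?_
    obtain ⟨N, hN⟩ := key P Q hP hQ (ε / 2) (half_pos hε)
    exact ⟨N, fun n hn => by
      rw [dist_zero_right]; exact (hN n hn n hn).trans_lt (half_lt_self hε)⟩
  simpa using hdiff.add hA

/-- The operator `φ(S*)` on `ℓ²(ℕ₀)` for `φ` in the disc algebra: the limit in operator norm of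
`Pₙ(S*)` for any polynomials `Pₙ` converging to `φ` uniformly on the closed unit disc. -/
def phiBackwardShift (φ : ℂ → ℂ) (hφ : DiffContOnCl ℂ φ (ball 0 1)) : Ell2 ℕ →L[ℂ] Ell2 ℕ :=
  (existsUnique_discCalculus hφ).choose

theorem tendsto_phiBackwardShift {φ : ℂ → ℂ} (hφ : DiffContOnCl ℂ φ (ball 0 1)) {P : ℕ → ℂ[X]}
    (hP : TendstoUniformlyOn (fun n z => (P n).eval z) φ atTop (closedBall 0 1)) :
    Tendsto (fun n => aeval backwardShift (P n)) atTop (𝓝 (phiBackwardShift φ hφ)) :=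
  (existsUnique_discCalculus hφ).choose_spec.1 P hP

/-! ### Toeplitz operators on the Hardy space

The unit circle is parametrised by `UnitAddCircle = ℝ/ℤ` through `AddCircle.toCircle`,
`t ↦ exp (2 π i t)`, with normalised arc length measure `AddCircle.haarAddCircle`. -/

/-- `L²` of the unit circle. -/
abbrev L2Circle : Type := Lp ℂ 2 (AddCircle.haarAddCircle (T := (1 : ℝ)))

/-- The Hardy space `H²`: the functions in `L²` of the circle whose Fourier coefficients of
negative index vanish, i.e. `f = ∑_{n ≥ 0} cₙ zⁿ` with `(cₙ) ∈ ℓ²(ℕ₀)`. -/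
def hardySpace : Submodule ℂ L2Circle :=
  ⨅ n : {n : ℤ // n < 0}, (innerSL ℂ (fourierLp (T := (1 : ℝ)) 2 n.1)).ker

theorem mem_hardySpace {f : L2Circle} :
    f ∈ hardySpace ↔ ∀ n : ℤ, n < 0 → fourierCoeff f n = 0 := by
  simp only [hardySpace, Submodule.mem_iInf, LinearMap.mem_ker, Subtype.forall]
  refine forall₂_congr fun n _ => ?_
  rw [← fourierBasis_repr, HilbertBasis.repr_apply_apply, coe_fourierBasis]
  rfl

theorem isClosed_hardySpace : IsClosed (hardySpace : Set L2Circle) := by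
  rw [hardySpace, Submodule.coe_iInf]
  exact isClosed_iInter fun n => ContinuousLinearMap.isClosed_ker _

instance : CompleteSpace hardySpace := isClosed_hardySpace.completeSpace_coe

/-- The Toeplitz operator `T_ψ f = P₊ (ψ f)` on `H²` with symbol `ψ ∈ L^∞` of the circle, where
`P₊` is the orthogonal projection of `L²` onto `H²`. -/
def toeplitz (ψ : UnitAddCircle → ℂ) (hψ : MemLp ψ ∞ AddCircle.haarAddCircle) :
    hardySpace →L[ℂ] hardySpace :=
  hardySpace.orthogonalProjectionOnto ∘L
    ((ContinuousLinearMap.mul ℂ ℂ).holderL AddCircle.haarAddCircle ∞ 2 2 (hψ.toLp ψ)) ∘L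
      hardySpace.subtypeL

/-- The boundary function `t ↦ conj (φ (exp (2 π i t)))` of a disc algebra function is bounded. -/
theorem memLp_conj_boundary {φ : ℂ → ℂ} (hφ : DiffContOnCl ℂ φ (ball 0 1)) :
    MemLp (fun t : UnitAddCircle => conj (φ (AddCircle.toCircle t))) ∞
      AddCircle.haarAddCircle := by
  have hc : Continuous fun t : UnitAddCircle => conj (φ (AddCircle.toCircle t)) := by
    refine Complex.continuous_conj.comp (hφ.continuousOn_ball.comp_continuous ?_ fun t => ?_)
    · exact continuous_subtype_val.comp AddCircle.continuous_toCircle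
    · rw [mem_closedBall_zero_iff, Circle.norm_coe]
  exact (BoundedContinuousFunction.mkOfCompact ⟨_, hc⟩).memLp_top

/-- The coanalytic Toeplitz operator with symbol the complex conjugate of the boundary function of
the disc algebra function `φ`. -/
def coanalyticToeplitz (φ : ℂ → ℂ) (hφ : DiffContOnCl ℂ φ (ball 0 1)) :
    hardySpace →L[ℂ] hardySpace :=
  toeplitz (fun t => conj (φ (AddCircle.toCircle t))) (memLp_conj_boundary hφ)

end HypSub

end

/-! The geometric sequences `geom z`, `|z| < 1`, are eigenvectors of `S*` with eigenvalue `z`, hence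
of `φ(S*)` with eigenvalue `φ z`. As `φ` is open on the disc and takes a unimodular value there,
`|φ| < 1` and `|φ| > 1` both hold on non-empty open sets. By the identity theorem the geometric
sequences over either set span a dense subspace (`dense_span_geom`). Orbits from the first span tend
to zero, and vectors in the second have backward orbits tending to zero: this is the hypercyclicity
criterion. If `ζ` and `φ ζ` are unimodular, the normalized `geom z`, as `z → ζ` radially, form a
weakly null sequence of approximate eigenvectors for `l = φ ζ`.

These data give a hypercyclic subspace (`hasHypercyclicSubspace_of_criterion`). An orthonormal
sequence `u r` of approximate eigenvectors is perturbed to vectors `e r` with orbits tending to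
zero, and small vectors `y r` with `T ^ n r` sending `y r` close to a target `τ r` are added. The
subspace consists of the sums `Φ a = ∑ (a r • e r + a (K r) • y r)`. Under `T ^ n s` the terms with
`r < s` have decayed, the term `r = s` yields about `a (K s) • τ s`, and the terms with `r > s`
yield about `l ^ n s` times a tail of `∑ a r • u r`. Since `|l| = 1`, this tail tends to zero,
although `T` need not be power bounded.

For the Toeplitz operator, the functions with coefficients `geom w` are eigenvectors with eigenvalue
`conj (φ (conj w))`. This is again a disc algebra function satisfying the hypotheses, so the same
argument applies after identifying `H²` with `ℓ²`. -/

noncomputable section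

namespace HypSub

/-! ### A criterion for the existence of hypercyclic subspaces -/

/-- Dependent choice with a step index and conditions relating each term to all previous ones. -/
theorem exists_seq_of_forall_lt_exists {α : Type*} [Nonempty α] (P : ℕ → α → Prop)
    (R : ℕ → α → α → Prop)
    (h : ∀ n, ∀ f : ℕ → α, (∀ m < n, P m (f m)) → (∀ k m, k < m → m < n → R m (f k) (f m)) →
      ∃ y, P n y ∧ ∀ m < n, R n (f m) y) :
    ∃ f : ℕ → α, (∀ n, P n (f n)) ∧ ∀ m n, m < n → R n (f m) (f n) := by
  let step : (n : ℕ) → ((m : ℕ) → m < n → α) → α := fun n g =>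
    Classical.epsilon fun y => P n y ∧ ∀ m (hm : m < n), R n (g m hm) y
  let f : ℕ → α := fun n => Nat.strongRec (motive := fun _ => α) step n
  have hf : ∀ n, f n = Classical.epsilon fun y => P n y ∧ ∀ m < n, R n (f m) y := by
    intro n
    change Nat.strongRec (motive := fun _ => α) step n = _
    rw [Nat.strongRec_eq]
  have key : ∀ n, P n (f n) ∧ ∀ m < n, R n (f m) (f n) := by
    intro n
    induction n using Nat.strong_induction_on with
    | _ n ih =>
      have := h n f (fun m hm => (ih m hm).1) (fun k m hk hm => (ih m hm).2 k hk)
      have h2 := Classical.epsilon_spec this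
      rw [← hf n] at h2
      exact h2
  exact ⟨f, fun n => (key n).1, fun m n hmn => (key n).2 m hmn⟩

theorem exists_mem_of_dense_of_eventually {X : Type*} [TopologicalSpace X] {s : Set X} (hs : Dense s)
    {p : X → Prop} {x : X} (h : ∀ᶠ y in 𝓝 x, p y) : ∃ y ∈ s, p y := by
  obtain ⟨y, hy, hp⟩ := hs.inter_nhds_nonempty h
  exact ⟨y, hy, hp⟩

/-! ### Approximate eigenvectors and the inductive choice of blocks -/

section Criterion

variable {X : Type*} [NormedAddCommGroup X] [InnerProductSpace ℂ X]

/-- Induction on `m`, from `T^(m+1) v - l^(m+1) v = T (T^m v - l^m v) + l^m (T v - l v)`. -/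
theorem tendsto_pow_sub_pow_smul (T : X →L[ℂ] X) (l : ℂ) {ι : Type*} {F : Filter ι} {v : ι → X}
    (hv : Tendsto (fun j => T (v j) - l • v j) F (𝓝 0)) (m : ℕ) :
    Tendsto (fun j => (T ^ m) (v j) - l ^ m • v j) F (𝓝 0) := by
  induction m with
  | zero => simpa using tendsto_const_nhds
  | succ m ih =>
    have h1 := (T.continuous.tendsto 0).comp ih
    have h2 := hv.const_smul (l ^ m)
    have h3 := h1.add h2
    simp only [map_zero, smul_zero, add_zero] at h3
    refine h3.congr fun j => ?_
    simp only [Function.comp, map_sub, map_smul, pow_succ', smul_sub, mul_apply_eq_comp]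
    rw [smul_smul, mul_comm (l ^ m) l]
    abel

/-- Approximate eigenvectors orthogonal to a given finite set. -/
theorem exists_orthogonal_approx_eigenvector (T : X →L[ℂ] X) {l : ℂ} {v : ℕ → X}
    (hv1 : ∀ j, ‖v j‖ = 1) (hvw : ∀ f : X, Tendsto (fun j => inner ℂ f (v j)) atTop (𝓝 0))
    (hvT : Tendsto (fun j => T (v j) - l • v j) atTop (𝓝 0))
    (n : ℕ) (u : ℕ → X) (hu : ∀ i < n, ∀ j < n, inner ℂ (u i) (u j) = if i = j then (1 : ℂ) else 0)
    (N : Finset ℕ) {ε : ℝ} (hε : 0 < ε) :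
    ∃ w : X, ‖w‖ = 1 ∧ (∀ i < n, inner ℂ (u i) w = 0) ∧
      ∀ m ∈ N, ‖(T ^ m) w - l ^ m • w‖ < ε := by
  -- `q j` is the projection of `v j` onto the span of the `u i`. Weak nullity forces `q j → 0`, so
  -- subtracting it spoils neither the norm nor the approximate eigenvector property in the limit,
  -- and renormalizing is harmless.
  let q : ℕ → X := fun j => ∑ i ∈ Finset.range n, (inner ℂ (u i) (v j) : ℂ) • u i
  let w : ℕ → X := fun j => v j - q j
  have hq : Tendsto q atTop (𝓝 0) := by
    have : Tendsto q atTop (𝓝 (∑ i ∈ Finset.range n, (0 : ℂ) • u i)) :=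
      tendsto_finsetSum _ fun i _ => (hvw (u i)).smul_const (u i)
    simpa using this
  have horth : ∀ j, ∀ i < n, inner ℂ (u i) (w j) = 0 := by
    intro j i hi
    simp only [w, q, inner_sub_right, inner_sum, inner_smul_right]
    rw [Finset.sum_eq_single i]
    · rw [hu i hi i hi]; simp
    · intro k hk hki
      rw [hu i hi k (Finset.mem_range.mp hk), if_neg (Ne.symm hki), mul_zero]
    · intro h; exact absurd (Finset.mem_range.mpr hi) h
  have hnorm : Tendsto (fun j => ‖w j‖) atTop (𝓝 1) := by
    have h1 : Tendsto (fun j => ‖w j‖ - ‖v j‖) atTop (𝓝 0) := by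
      refine squeeze_zero_norm (fun j => ?_) (by simpa using hq.norm)
      have h := abs_norm_sub_norm_le (w j) (v j)
      simpa [w] using h
    simpa [hv1] using h1.add_const 1
  have hwT : Tendsto (fun j => T (w j) - l • w j) atTop (𝓝 0) := by
    have h1 := hvT.sub (((T.continuous.tendsto 0).comp hq).sub (hq.const_smul l))
    simp only [map_zero, smul_zero, sub_zero] at h1
    refine h1.congr fun j => ?_
    simp only [Function.comp, w, map_sub, smul_sub]
    abel
  have hinv : Tendsto (fun j => ((‖w j‖ : ℂ))⁻¹) atTop (𝓝 1) := by
    have := ((Complex.continuous_ofReal.tendsto 1).comp hnorm).inv₀ (by simp)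
    simpa using this
  have hall : ∀ᶠ j in atTop, ∀ m ∈ N,
      ‖((‖w j‖ : ℂ))⁻¹ • ((T ^ m) (w j) - l ^ m • w j)‖ < ε := by
    rw [Filter.eventually_all_finset]
    intro m _
    have h1 := (hinv.smul (tendsto_pow_sub_pow_smul T l hwT m)).norm
    simp only [smul_zero, norm_zero] at h1
    exact h1.eventually (gt_mem_nhds hε)
  obtain ⟨j, hj, hpos⟩ := (hall.and (hnorm.eventually (lt_mem_nhds one_pos))).exists
  refine ⟨((‖w j‖ : ℂ))⁻¹ • w j, ?_, fun i hi => ?_, fun m hm => ?_⟩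
  · rw [norm_smul, norm_inv, Complex.norm_real, norm_norm, inv_mul_cancel₀ hpos.ne']
  · rw [inner_smul_right, horth j i hi, mul_zero]
  · have := hj m hm
    rwa [smul_sub, smul_comm _ (l ^ m), ← map_smul] at this

/-- One step of the construction of a basic sequence spanning a hypercyclic subspace. -/
structure Block (X : Type*) where
  /-- A member of an orthonormal sequence. -/
  u : X
  /-- A perturbation of `u` whose orbit tends to zero. -/
  e : X
  /-- A small vector which an iterate of the operator brings close to a target. -/
  y : X
  /-- The exponent of that iterate. -/
  n : ℕ

/-- The order of choice within a block matters: first `u`, nearly an eigenvector for all earlier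
iterates, then `e ∈ Y₀` near `u`, then an exponent `n` so large that all previous vectors and `e`
have decayed, and finally `y`. Both `e` and `y` lie in `Y₀`, so that they in turn decay under the
exponents of later blocks. -/
theorem exists_block_seq (T : X →L[ℂ] X) {Y₀ Z₀ : Set X} (hY₀ : Dense Y₀)
    (hY : ∀ y ∈ Y₀, Tendsto (fun n => (T ^ n) y) atTop (𝓝 0)) (hZ₀ : Dense Z₀)
    (hZ : ∀ z ∈ Z₀, ∃ w : ℕ → X, Tendsto w atTop (𝓝 0) ∧ ∀ n, (T ^ n) (w n) = z)
    {l : ℂ} {v : ℕ → X} (hv1 : ∀ j, ‖v j‖ = 1)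
    (hvw : ∀ f : X, Tendsto (fun j => inner ℂ f (v j)) atTop (𝓝 0))
    (hvT : Tendsto (fun j => T (v j) - l • v j) atTop (𝓝 0))
    (τ : ℕ → X) (ε : ℕ → ℝ) (hε : ∀ n, 0 < ε n) :
    ∃ b : ℕ → Block X, Orthonormal ℂ (fun r => (b r).u) ∧
      (∀ r, ‖(b r).e - (b r).u‖ ≤ ε r ∧ ‖(b r).y‖ ≤ ε r) ∧
      (∀ r, ‖(T ^ (b r).n) (b r).e‖ ≤ ε r ∧ ‖(T ^ (b r).n) (b r).y - τ r‖ ≤ ε r) ∧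
      (∀ r s, r < s → ‖(T ^ (b s).n) (b r).e‖ ≤ ε s ∧ ‖(T ^ (b s).n) (b r).y‖ ≤ ε s) ∧
      (∀ s r, s < r → ‖(T ^ (b s).n) (b r).e - l ^ (b s).n • (b r).u‖ ≤ ε r ∧
        ‖(T ^ (b s).n) (b r).y‖ ≤ ε r) := by
  have : Nonempty (Block X) := ⟨⟨0, 0, 0, 0⟩⟩
  refine Exists.elim (exists_seq_of_forall_lt_exists (α := Block X)
    (fun r x => x.e ∈ Y₀ ∧ x.y ∈ Y₀ ∧ ‖x.u‖ = 1 ∧ ‖x.e - x.u‖ ≤ ε r ∧ ‖x.y‖ ≤ ε r ∧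
      ‖(T ^ x.n) x.e‖ ≤ ε r ∧ ‖(T ^ x.n) x.y - τ r‖ ≤ ε r)
    (fun r x y => inner ℂ x.u y.u = 0 ∧ ‖(T ^ y.n) x.e‖ ≤ ε r ∧ ‖(T ^ y.n) x.y‖ ≤ ε r ∧
      ‖(T ^ x.n) y.e - l ^ x.n • y.u‖ ≤ ε r ∧ ‖(T ^ x.n) y.y‖ ≤ ε r) ?_) ?_
  rotate_left
  · rintro b ⟨hP, hR⟩
    refine ⟨b, ⟨fun r => (hP r).2.2.1, fun i j hij => ?_⟩, fun r => ⟨(hP r).2.2.2.1, (hP r).2.2.2.2.1⟩,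
      fun r => (hP r).2.2.2.2.2, fun r s h => ⟨(hR r s h).2.1, (hR r s h).2.2.1⟩,
      fun s r h => (hR s r h).2.2.2⟩
    rcases lt_or_gt_of_ne hij with h | h
    · exact (hR i j h).1
    · exact inner_eq_zero_symm.mp (hR j i h).1
  intro k f hf hff
  let N : Finset ℕ := (Finset.range k).image fun m => (f m).n
  have hN : ∀ m < k, (f m).n ∈ N := fun m hm =>
    Finset.mem_image_of_mem _ (Finset.mem_range.mpr hm)
  obtain ⟨u, hu1, huo, huT⟩ := exists_orthogonal_approx_eigenvector T hv1 hvw hvT k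
    (fun m => (f m).u) (by
      intro i hi j hj
      rcases lt_trichotomy i j with h | rfl | h
      · rw [if_neg h.ne]; exact (hff i j h hj).1
      · rw [if_pos rfl, inner_self_eq_norm_sq_to_K, (hf i hi).2.2.1]; simp
      · rw [if_neg h.ne']; exact inner_eq_zero_symm.mp (hff j i h hi).1) N (hε k)
  have small : ∀ m, ∀ c : X, ∀ x : X, ‖(T ^ m) x - c‖ < ε k →
      ∀ᶠ x' in 𝓝 x, ‖(T ^ m) x' - c‖ < ε k := by
    intro m c x hx
    have hc : Continuous fun x' => ‖(T ^ m) x' - c‖ :=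
      (((T ^ m).continuous).sub continuous_const).norm
    exact hc.continuousAt.eventually (gt_mem_nhds hx)
  -- The zeroth power expresses closeness of `e` to `u` itself, so that `small` covers every
  -- condition.
  obtain ⟨e, heY, he⟩ := exists_mem_of_dense_of_eventually hY₀ (p := fun e =>
      ‖(T ^ 0) e - u‖ < ε k ∧ ∀ m ∈ N, ‖(T ^ m) e - l ^ m • u‖ < ε k) (x := u) (by
    refine (small 0 u u (by simpa using hε k)).and ?_
    rw [Filter.eventually_all_finset]
    exact fun m hm => small m _ u (huT m hm))
  obtain ⟨w, hwZ, hw⟩ := exists_mem_of_dense_of_eventually hZ₀ (p := fun w => ‖(T ^ 0) w - τ k‖ < ε k)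
    (x := τ k) (small 0 (τ k) (τ k) (by simpa using hε k))
  obtain ⟨q, hq0, hqT⟩ := hZ w hwZ
  have lim : ∀ y ∈ Y₀, ∀ᶠ n in atTop, ‖(T ^ n) y‖ < ε k := fun y hy => by
    have := (hY y hy).norm
    rw [norm_zero] at this
    exact this.eventually (gt_mem_nhds (hε k))
  have hev : ∀ᶠ n in atTop, ‖(T ^ n) e‖ < ε k ∧
      (∀ m ∈ Finset.range k, ‖(T ^ n) (f m).e‖ < ε k ∧ ‖(T ^ n) (f m).y‖ < ε k) ∧
      (‖(T ^ 0) (q n) - 0‖ < ε k ∧ ∀ m ∈ N, ‖(T ^ m) (q n) - 0‖ < ε k) := by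
    refine (lim e heY).and (Filter.Eventually.and ?_ ?_)
    · rw [Filter.eventually_all_finset]
      intro m hm
      have := hf m (Finset.mem_range.mp hm)
      exact (lim _ this.1).and (lim _ this.2.1)
    · have h0 : ∀ᶠ x in 𝓝 (0 : X), ‖(T ^ 0) x - 0‖ < ε k ∧ ∀ m ∈ N, ‖(T ^ m) x - 0‖ < ε k := by
        refine (small 0 0 0 (by simpa using hε k)).and ?_
        rw [Filter.eventually_all_finset]
        exact fun m hm => small m 0 0 (by simpa using hε k)
      exact hq0.eventually h0
  obtain ⟨n, hne, hnf, hnq0, hnq⟩ := hev.exists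
  -- `q n` is small and is sent exactly to `w`, near the target, but its orbit need not tend to
  -- zero; a nearby point of `Y₀` is taken instead.
  obtain ⟨y, hyY, hy0, hyN, hyτ⟩ := exists_mem_of_dense_of_eventually hY₀ (p := fun y =>
      ‖(T ^ 0) y - 0‖ < ε k ∧ (∀ m ∈ N, ‖(T ^ m) y - 0‖ < ε k) ∧ ‖(T ^ n) y - τ k‖ < ε k)
      (x := q n) (by
    refine (small 0 0 _ hnq0).and (Filter.Eventually.and ?_ (small n _ _ ?_))
    · rw [Filter.eventually_all_finset]
      exact fun m hm => small m 0 _ (hnq m hm)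
    · rw [hqT]; simpa using hw)
  simp only [sub_zero] at hy0 hyN
  refine ⟨⟨u, e, y, n⟩, ⟨heY, hyY, hu1, by simpa using he.1.le, by simpa using hy0.le, hne.le,
    hyτ.le⟩, fun m hm => ?_⟩
  have h1 := hnf m (Finset.mem_range.mpr hm)
  exact ⟨huo m hm, h1.1.le, h1.2.le, (he.2 _ (hN m hm)).le, (hyN _ (hN m hm)).le⟩

end Criterion

/-! ### Embedding `ℓ²` onto a hypercyclic subspace -/

/-- The `i`-th coordinate functional on `ℓ²`. -/
def coordCLM (i : ℕ) : Ell2 ℕ →L[ℂ] ℂ :=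
  LinearMap.mkContinuous
    { toFun := fun a => a i
      map_add' := fun _ _ => rfl
      map_smul' := fun _ _ => rfl } 1 fun a => by
    rw [one_mul]
    exact lp.norm_apply_le_norm two_ne_zero a i

@[simp] theorem coordCLM_apply (i : ℕ) (a : Ell2 ℕ) : coordCLM i a = a i := rfl

theorem norm_coordCLM_le (i : ℕ) : ‖coordCLM i‖ ≤ 1 :=
  LinearMap.mkContinuous_norm_le _ zero_le_one _

theorem not_finiteDimensional_ell2 : ¬ FiniteDimensional ℂ (Ell2 ℕ) := by
  intro h
  have hli : LinearIndependent ℂ fun i : ℕ => (lp.single 2 i (1 : ℂ) : Ell2 ℕ) := by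
    refine Orthonormal.linearIndependent ⟨fun i => by simp [lp.norm_single], fun i j hij => ?_⟩
    beta_reduce
    rw [lp.inner_single_left]
    simp [lp.single_apply, hij]
  have := hli.finite
  exact not_finite ℕ

section Criterion

variable {X : Type*} [NormedAddCommGroup X] [InnerProductSpace ℂ X]

/-- A map bounded below is injective with closed range, so its range inherits completeness and
infinite dimension from `ℓ²`. -/
theorem isHypercyclicSubspace_range [CompleteSpace X] {T : X →L[ℂ] X} (Φ : Ell2 ℕ →L[ℂ] X) {c : ℝ}
    (hc : 0 < c) (hΦ : ∀ a, c * ‖a‖ ≤ ‖Φ a‖)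
    (hT : ∀ a, a ≠ 0 → IsHypercyclicVector T (Φ a)) :
    IsHypercyclicSubspace T (LinearMap.range (Φ : Ell2 ℕ →ₗ[ℂ] X)) := by
  have hanti : AntilipschitzWith (⟨c, hc.le⟩ : NNReal)⁻¹ Φ := by
    refine AddMonoidHomClass.antilipschitz_of_bound Φ fun a => ?_
    have := hΦ a
    change _ ≤ c⁻¹ * _
    rwa [← div_eq_inv_mul, le_div_iff₀' hc]
  refine ⟨?_, fun h => not_finiteDimensional_ell2 ?_, ?_⟩
  · have := hanti.isClosed_range Φ.uniformContinuous
    rwa [LinearMap.coe_range]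
  · exact (LinearEquiv.ofInjective (Φ : Ell2 ℕ →ₗ[ℂ] X) hanti.injective).symm.finiteDimensional
  · rintro _ ⟨a, rfl⟩ ha
    exact hT a fun h => ha (by simp [h])

/-- A criterion in the spirit of González, León-Saavedra and Montes-Rodríguez: an operator satisfying
the hypercyclicity criterion and having a weakly null sequence of approximate eigenvectors for a
unimodular number has a hypercyclic subspace. -/
theorem hasHypercyclicSubspace_of_criterion [CompleteSpace X] [TopologicalSpace.SeparableSpace X]
    (T : X →L[ℂ] X) {Y₀ Z₀ : Set X} (hY₀ : Dense Y₀)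
    (hY : ∀ y ∈ Y₀, Tendsto (fun n => (T ^ n) y) atTop (𝓝 0)) (hZ₀ : Dense Z₀)
    (hZ : ∀ z ∈ Z₀, ∃ w : ℕ → X, Tendsto w atTop (𝓝 0) ∧ ∀ n, (T ^ n) (w n) = z)
    {l : ℂ} (hl : ‖l‖ = 1) {v : ℕ → X} (hv1 : ∀ j, ‖v j‖ = 1)
    (hvw : ∀ f : X, Tendsto (fun j => inner ℂ f (v j)) atTop (𝓝 0))
    (hvT : Tendsto (fun j => T (v j) - l • v j) atTop (𝓝 0)) :
    HasHypercyclicSubspace T := by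
  -- The sum of `ε` is `1/3`, so the perturbation of the isometry `U` has norm at most `2/3` and `Φ`
  -- stays bounded below by `1/3`. Also `ε q ≤ 2^(-p) 2^(-q)` for `p ≤ q`, which makes the errors at
  -- time `s` summable with total `O(2^(-s))`.
  let ε : ℕ → ℝ := fun r => (1 / 4) ^ (r + 1)
  have hε : ∀ r, 0 < ε r := fun r => by positivity
  have hεs : HasSum ε (1 / 3) := by
    have := (hasSum_geometric_of_lt_one (r := (1 / 4 : ℝ)) (by norm_num) (by norm_num)).mul_left
      (1 / 4)
    rw [show (1 / 4 : ℝ) * (1 - 1 / 4)⁻¹ = 1 / 3 by norm_num] at this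
    have h : ε = fun r => 1 / 4 * (1 / 4) ^ r := funext fun r => pow_succ' _ _
    rwa [h]
  -- The index `s` encodes a coordinate, a target and a dummy counter. The counter makes each pair
  -- of coordinate and target recur infinitely often.
  let K : ℕ → ℕ := fun s => s.unpair.1
  let τ : ℕ → X := fun s => TopologicalSpace.denseSeq X s.unpair.2.unpair.1
  obtain ⟨b, hbu, hb1, hb2, hb3, hb4⟩ :=
    exists_block_seq T hY₀ hY hZ₀ hZ hv1 hvw hvT τ ε hε
  let U : Ell2 ℕ →ₗᵢ[ℂ] X := hbu.orthogonalFamily.linearIsometry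
  have hU : ∀ a : Ell2 ℕ, HasSum (fun i => a i • (b i).u) (U a) := fun a =>
    hbu.orthogonalFamily.hasSum_linearIsometry a
  let A : ℕ → Ell2 ℕ →L[ℂ] X := fun r =>
    (coordCLM r).smulRight ((b r).e - (b r).u) + (coordCLM (K r)).smulRight (b r).y
  have hA : ∀ r, ‖A r‖ ≤ 2 * ε r := by
    intro r
    refine (norm_add_le _ _).trans ?_
    rw [ContinuousLinearMap.norm_smulRight_apply, ContinuousLinearMap.norm_smulRight_apply]
    have h1 := mul_le_mul (norm_coordCLM_le r) (hb1 r).1 (norm_nonneg _) zero_le_one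
    have h2 := mul_le_mul (norm_coordCLM_le (K r)) (hb1 r).2 (norm_nonneg _) zero_le_one
    linarith
  have hAs : HasSum A (∑' r, A r) :=
    (Summable.of_norm_bounded (hεs.mul_left 2).summable hA).hasSum
  have hAn : ‖∑' r, A r‖ ≤ 2 * (1 / 3) := tsum_of_norm_bounded (hεs.mul_left 2) hA
  let Φ : Ell2 ℕ →L[ℂ] X := U.toContinuousLinearMap + ∑' r, A r
  have hΦ : ∀ a, HasSum (fun r => a r • (b r).e + a (K r) • (b r).y) (Φ a) := by
    intro a
    have h1 := (ContinuousLinearMap.apply ℂ X a).hasSum hAs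
    change HasSum _ (U a + (ContinuousLinearMap.apply ℂ X a) (∑' r, A r))
    convert (hU a).add h1 using 1
    ext r
    simp only [A, ContinuousLinearMap.apply_apply, add_apply,
      ContinuousLinearMap.smulRight_apply, coordCLM_apply, smul_sub]
    abel
  have hlow : ∀ a, 1 / 3 * ‖a‖ ≤ ‖Φ a‖ := by
    intro a
    have h1 : ‖(∑' r, A r) a‖ ≤ 2 * (1 / 3) * ‖a‖ := ContinuousLinearMap.le_of_opNorm_le _ hAn a
    have h2 : U a = Φ a - (∑' r, A r) a := by simp [Φ]
    have h3 := norm_sub_le (Φ a) ((∑' r, A r) a)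
    rw [← h2, U.norm_map] at h3
    linarith
  -- the error in approximating `a (K s) • τ s` tends to zero
  have herr : ∀ a : Ell2 ℕ,
      Tendsto (fun s => (T ^ (b s).n) (Φ a) - a (K s) • τ s) atTop (𝓝 0) := by
    intro a
    have ha : ∀ i, ‖a i‖ ≤ ‖a‖ := fun i => lp.norm_apply_le_norm two_ne_zero a i
    -- tails of the orthonormal expansion
    let tail : ℕ → X := fun s => U a - ∑ i ∈ Finset.range (s + 1), a i • (b i).u
    have htail : Tendsto tail atTop (𝓝 0) := by
      have := ((hU a).tendsto_sum_nat.comp (tendsto_add_atTop_nat 1)).const_sub (U a)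
      simpa [tail] using this
    have htailsum : ∀ s, HasSum (fun r => if r ≤ s then 0 else a r • (b r).u) (tail s) := by
      intro s
      have h1 : HasSum (fun r => if r ∈ Finset.range (s + 1) then a r • (b r).u else 0)
          (∑ i ∈ Finset.range (s + 1), a i • (b i).u) := by
        have := hasSum_sum_of_ne_finset_zero (L := SummationFilter.unconditional ℕ) (s := Finset.range (s + 1))
          (f := fun r => if r ∈ Finset.range (s + 1) then a r • (b r).u else 0)
          (fun r hr => if_neg hr)
        convert this using 1
        exact Finset.sum_congr rfl fun r hr => (if_pos hr).symm
      convert (hU a).sub h1 using 1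
      ext r
      by_cases h : r ≤ s
      · simp [h, Nat.lt_succ_of_le h]
      · simp [h]
    -- The three series are compared term by term. The `r`-th difference is governed by `hb3`, `hb2`
    -- or `hb4` according as `r < s`, `r = s` or `r > s`, and is at most `2 ‖a‖ ε (max r s)`.
    have hbound : ∀ s, ‖(T ^ (b s).n) (Φ a) - a (K s) • τ s - l ^ (b s).n • tail s‖ ≤
        2 * ‖a‖ * (2 * (1 / 2) ^ s) := by
      intro s
      have h1 := (((T ^ (b s).n).hasSum (hΦ a)).sub (hasSum_ite_eq s (a (K s) • τ s))).sub
        ((htailsum s).const_smul (l ^ (b s).n))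
      have hg : HasSum (fun r : ℕ => 2 * ‖a‖ * ((1 / 2 : ℝ) ^ r * (1 / 2) ^ s))
          (2 * ‖a‖ * (2 * (1 / 2) ^ s)) :=
        (hasSum_geometric_two.mul_right _).mul_left _
      rw [← h1.tsum_eq]
      refine tsum_of_norm_bounded hg fun r => ?_
      have comb : ∀ (x y : X) (i : ℕ) (δ : ℝ), ‖x‖ ≤ δ → ‖y‖ ≤ δ →
          ‖a r • x + a i • y‖ ≤ 2 * ‖a‖ * δ := by
        intro x y i δ hx hy
        refine (norm_add_le _ _).trans ?_
        rw [norm_smul, norm_smul]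
        have h1 := mul_le_mul (ha r) hx (norm_nonneg _) (norm_nonneg a)
        have h2 := mul_le_mul (ha i) hy (norm_nonneg _) (norm_nonneg a)
        linarith
      have hεle : ∀ p q : ℕ, p ≤ q → ε q ≤ (1 / 2) ^ p * (1 / 2) ^ q := by
        intro p q hpq
        have h4 : (1 / 4 : ℝ) = (1 / 2) ^ 2 := by norm_num
        simp only [ε]
        rw [h4, ← pow_mul, ← pow_add]
        exact pow_le_pow_of_le_one (by norm_num) (by norm_num) (by omega)
      rcases lt_trichotomy r s with h | rfl | h
      · have := comb _ _ (K r) _ (hb3 r s h).1 (hb3 r s h).2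
        simp only [h.ne, h.le, if_true, if_false, map_add, map_smul, sub_zero,
          smul_zero]
        exact this.trans (mul_le_mul_of_nonneg_left (hεle r s h.le) (by positivity))
      · have := comb _ _ (K r) _ (hb2 r).1 (hb2 r).2
        simp only [le_refl, if_true, map_add, map_smul, sub_zero, smul_zero]
        rw [add_sub_assoc, ← smul_sub]
        exact this.trans (mul_le_mul_of_nonneg_left (hεle r r le_rfl) (by positivity))
      · have := comb _ _ (K r) _ (hb4 s r h).1 (hb4 s r h).2
        simp only [h.ne', h.not_ge, if_false, map_add, map_smul, sub_zero]
        rw [smul_comm, add_sub_right_comm, ← smul_sub, mul_comm ((1 / 2 : ℝ) ^ r)]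
        exact this.trans (mul_le_mul_of_nonneg_left (hεle s r h.le) (by positivity))
    have h1 : Tendsto (fun s => (T ^ (b s).n) (Φ a) - a (K s) • τ s - l ^ (b s).n • tail s) atTop
        (𝓝 0) := by
      refine squeeze_zero_norm hbound ?_
      have := ((tendsto_pow_atTop_nhds_zero_of_lt_one (r := (1 / 2 : ℝ)) (by norm_num)
        (by norm_num)).const_mul 2).const_mul (2 * ‖a‖)
      simpa using this
    have h2 : Tendsto (fun s => l ^ (b s).n • tail s) atTop (𝓝 0) := by
      refine squeeze_zero_norm (fun s => ?_) (by simpa using htail.norm)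
      rw [norm_smul, norm_pow, hl, one_pow, one_mul]
    simpa using h1.add h2
  refine ⟨_, isHypercyclicSubspace_range Φ (c := 1 / 3) (by norm_num) hlow fun a ha => ?_⟩
  obtain ⟨k, hk⟩ : ∃ k, a k ≠ 0 := by
    by_contra! h
    exact ha (lp.ext (funext h))
  -- To reach `x`, a target near `(a k)⁻¹ • x` is chosen and `s` runs through the indices encoding
  -- it with coordinate `k`.
  refine Metric.dense_iff.mpr fun x δ hδ => ?_
  obtain ⟨_, ⟨j, rfl⟩, hj⟩ := exists_mem_of_dense_of_eventually
    (TopologicalSpace.denseRange_denseSeq X) (x := (a k)⁻¹ • x)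
    (p := fun y => ‖a k • y - x‖ < δ / 2) (by
      have hc : Continuous fun y => ‖a k • y - x‖ := by fun_prop
      refine hc.continuousAt.eventually (gt_mem_nhds ?_)
      have h0 : a k • (a k)⁻¹ • x - x = 0 := by rw [smul_inv_smul₀ hk, sub_self]
      simpa only [h0, norm_zero] using half_pos hδ)
  have hs : Tendsto (fun r : ℕ => Nat.pair k (Nat.pair j r)) atTop atTop := by
    refine tendsto_atTop_mono (fun r => ?_) tendsto_id
    exact (Nat.right_le_pair j r).trans (Nat.right_le_pair k _)
  have hev := ((herr a).comp hs).norm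
  rw [norm_zero] at hev
  obtain ⟨r, hr⟩ := (hev.eventually (gt_mem_nhds (half_pos hδ))).exists
  simp only [Function.comp, K, τ, Nat.unpair_pair] at hr
  refine ⟨_, ?_, ⟨(b (Nat.pair k (Nat.pair j r))).n, rfl⟩⟩
  rw [Metric.mem_ball, dist_eq_norm]
  calc _ ≤ _ := norm_sub_le_norm_sub_add_norm_sub _ (a k • TopologicalSpace.denseSeq X j) _
    _ < δ / 2 + δ / 2 := add_lt_add hr hj
    _ = δ := add_halves δ

end Criterion

/-! ### Geometric sequences as eigenvectors -/

theorem tendsto_inner_of_dense {X : Type*} [NormedAddCommGroup X] [InnerProductSpace ℂ X]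
    {D : Set X} (hD : Dense D) {v : ℕ → X} (hv : ∀ j, ‖v j‖ = 1)
    (h : ∀ f ∈ D, Tendsto (fun j => inner ℂ f (v j)) atTop (𝓝 0)) (f : X) :
    Tendsto (fun j => inner ℂ f (v j)) atTop (𝓝 0) := by
  refine Metric.tendsto_nhds.mpr fun ε hε => ?_
  obtain ⟨g, hg, hfg⟩ := hD.exists_dist_lt f (half_pos hε)
  filter_upwards [(Metric.tendsto_nhds.mp (h g hg)) (ε / 2) (half_pos hε)] with j hj
  rw [dist_zero_right] at hj ⊢
  have h1 : inner ℂ f (v j) = inner ℂ (f - g) (v j) + inner ℂ g (v j) := by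
    rw [inner_sub_left, sub_add_cancel]
  have h2 := norm_inner_le_norm (𝕜 := ℂ) (f - g) (v j)
  rw [hv, mul_one] at h2
  rw [dist_eq_norm] at hfg
  rw [h1]
  linarith [norm_add_le (inner ℂ (f - g) (v j)) (inner ℂ g (v j))]

/-- A set of vectors has dense span if only the zero vector is orthogonal to all of them. -/
theorem dense_span_of_inner_eq_zero {X : Type*} [NormedAddCommGroup X] [InnerProductSpace ℂ X]
    [CompleteSpace X] {S : Set X} (h : ∀ f : X, (∀ x ∈ S, inner ℂ f x = 0) → f = 0) :
    Dense (Submodule.span ℂ S : Set X) := by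
  rw [Submodule.dense_iff_topologicalClosure_eq_top, Submodule.topologicalClosure_eq_top_iff,
    Submodule.eq_bot_iff]
  intro f hf
  exact h f fun x hx => inner_eq_zero_symm.mp
    ((Submodule.mem_orthogonal _ f).mp hf x (Submodule.subset_span hx))

theorem dense_span_single :
    Dense (Submodule.span ℂ (Set.range fun i : ℕ => (lp.single 2 i (1 : ℂ) : Ell2 ℕ)) :
      Set (Ell2 ℕ)) := by
  refine dense_span_of_inner_eq_zero fun f hf => lp.ext (funext fun i => ?_)
  have := hf _ ⟨i, rfl⟩
  rw [lp.inner_single_right] at this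
  simpa using this

instance : TopologicalSpace.SeparableSpace (Ell2 ℕ) := by
  rw [← TopologicalSpace.isSeparable_univ_iff, ← dense_span_single.closure_eq]
  exact ((Set.countable_range _).isSeparable.span (R := ℂ)).closure

/-- The geometric sequence `(1, z, z², …)`, an element of `ℓ²` for `‖z‖ < 1`, and zero for
other `z`. -/
def geom (z : ℂ) : Ell2 ℕ :=
  if h : ‖z‖ < 1 then ⟨fun n => z ^ n, by
    refine memℓp_gen ?_
    have h1 := summable_geometric_of_lt_one (sq_nonneg ‖z‖) (pow_lt_one₀ (norm_nonneg z) h two_ne_zero)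
    refine h1.congr fun n => ?_
    simp [← pow_mul, mul_comm]⟩ else 0

theorem geom_apply {z : ℂ} (hz : ‖z‖ < 1) (n : ℕ) : geom z n = z ^ n := by
  rw [geom, dif_pos hz]

theorem norm_geom_sq {z : ℂ} (hz : ‖z‖ < 1) : ‖geom z‖ ^ 2 = (1 - ‖z‖ ^ 2)⁻¹ := by
  have h := lp.hasSum_norm (p := 2) (by norm_num) (geom z)
  have h1 := hasSum_geometric_of_lt_one (sq_nonneg ‖z‖) (pow_lt_one₀ (norm_nonneg z) hz two_ne_zero)
  have h2 : HasSum (fun n => (‖z‖ ^ 2) ^ n) (‖geom z‖ ^ 2) := by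
    convert h using 1
    · ext n
      simp [geom_apply hz, ← pow_mul, mul_comm]
    · simp
  exact h2.unique h1

theorem geom_ne_zero {z : ℂ} (hz : ‖z‖ < 1) : geom z ≠ 0 := by
  intro h
  have := geom_apply hz 0
  simp [h] at this

theorem hasSum_inner_geom (f : Ell2 ℕ) {z : ℂ} (hz : ‖z‖ < 1) :
    HasSum (fun n => conj (f n) * z ^ n) (inner ℂ f (geom z)) := by
  have h := lp.hasSum_inner (𝕜 := ℂ) f (geom z)
  simpa only [geom_apply hz, RCLike.inner_apply, mul_comm] using h

/-- The geometric sequences with ratio in a non-empty open subset of the disc span `ℓ²`. -/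
theorem dense_span_geom {U : Set ℂ} (hU : IsOpen U) (hne : U.Nonempty) (hsub : U ⊆ ball 0 1) :
    Dense (Submodule.span ℂ (geom '' U) : Set (Ell2 ℕ)) := by
  refine dense_span_of_inner_eq_zero fun f hf => ?_
  -- If `f` is orthogonal to the given vectors, the holomorphic function `z ↦ ∑ conj (f n) z ^ n`
  -- vanishes on `U`, hence on the disc, and all its coefficients are zero.
  let p := FormalMultilinearSeries.ofScalars ℂ fun n => conj (f n)
  have hrad : 1 ≤ p.radius := by
    refine le_of_eq_of_le (by simp) (p.le_radius_of_bound (r := 1) ‖f‖ fun n => ?_)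
    simp only [p, NNReal.coe_one, one_pow, mul_one]
    rw [FormalMultilinearSeries.ofScalars_norm, RCLike.norm_conj]
    exact lp.norm_apply_le_norm two_ne_zero f n
  have hps : HasFPowerSeriesOnBall (fun z => inner ℂ f (geom z)) p 0 1 := by
    refine ⟨hrad, one_pos, fun {y} hy => ?_⟩
    rw [zero_add]
    have hy1 : ‖y‖ < 1 := by simpa [← toReal_enorm] using ENNReal.toReal_strict_mono ENNReal.one_ne_top hy
    have h := hasSum_inner_geom f hy1
    simpa only [p, FormalMultilinearSeries.ofScalars_apply_eq, smul_eq_mul] using h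
  have han : AnalyticOnNhd ℂ (fun z => inner ℂ f (geom z)) (ball 0 1) := by
    have := hps.analyticOnNhd
    rwa [show (1 : ℝ≥0∞) = ENNReal.ofReal 1 by simp, Metric.eball_ofReal] at this
  obtain ⟨z₀, hz₀⟩ := hne
  have hzero := han.eqOn_zero_of_preconnected_of_eventuallyEq_zero
    (convex_ball 0 1).isPreconnected (hsub hz₀)
    (Filter.mem_of_superset (hU.mem_nhds hz₀) fun z hz => hf _ ⟨z, hz, rfl⟩)
  have hps0 : HasFPowerSeriesAt (0 : ℂ → ℂ) p 0 := by
    refine hps.hasFPowerSeriesAt.congr ?_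
    exact Filter.mem_of_superset (ball_mem_nhds 0 one_pos) fun z hz => hzero hz
  have hp := hps0.eq_zero
  refine lp.ext (funext fun n => ?_)
  have h1 : p.coeff n = 0 := by rw [hp]; rfl
  simpa [p] using h1

theorem pow_apply_of_eigen {X : Type*} [NormedAddCommGroup X] [NormedSpace ℂ X] {T : X →L[ℂ] X}
    {x : X} {c : ℂ} (h : T x = c • x) (n : ℕ) : (T ^ n) x = c ^ n • x := by
  induction n with
  | zero => simp
  | succ n ih => rw [pow_succ, mul_apply_eq_comp, h, map_smul, ih, smul_smul, pow_succ']

/-- Orbits of linear combinations of eigenvectors with eigenvalues in the open disc tend to zero. -/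
theorem tendsto_pow_of_mem_span {X : Type*} [NormedAddCommGroup X] [NormedSpace ℂ X]
    {T : X →L[ℂ] X} {S : Set X} (hS : ∀ x ∈ S, ∃ c : ℂ, ‖c‖ < 1 ∧ T x = c • x) {y : X}
    (hy : y ∈ Submodule.span ℂ S) : Tendsto (fun n => (T ^ n) y) atTop (𝓝 0) := by
  induction hy using Submodule.span_induction with
  | mem x hx =>
    obtain ⟨c, hc, h⟩ := hS x hx
    simpa [pow_apply_of_eigen h] using (tendsto_pow_atTop_nhds_zero_of_norm_lt_one hc).smul_const x
  | zero => simp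
  | add x y _ _ hx hy => simpa using hx.add hy
  | smul a x _ hx => simpa using hx.const_smul a

/-- Linear combinations of eigenvectors with eigenvalues outside the closed disc have backward
orbits tending to zero. -/
theorem exists_backward_orbit_of_mem_span {X : Type*} [NormedAddCommGroup X] [NormedSpace ℂ X]
    {T : X →L[ℂ] X} {S : Set X} (hS : ∀ x ∈ S, ∃ c : ℂ, 1 < ‖c‖ ∧ T x = c • x) {z : X}
    (hz : z ∈ Submodule.span ℂ S) :
    ∃ w : ℕ → X, Tendsto w atTop (𝓝 0) ∧ ∀ n, (T ^ n) (w n) = z := by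
  induction hz using Submodule.span_induction with
  | mem x hx =>
    obtain ⟨c, hc, h⟩ := hS x hx
    refine ⟨fun n => (c⁻¹) ^ n • x, ?_, fun n => ?_⟩
    · have : ‖c⁻¹‖ < 1 := by rw [norm_inv]; exact inv_lt_one_of_one_lt₀ hc
      simpa using (tendsto_pow_atTop_nhds_zero_of_norm_lt_one this).smul_const x
    · have hc0 : c ≠ 0 := norm_pos_iff.mp (one_pos.trans hc)
      rw [map_smul, pow_apply_of_eigen h, smul_smul, ← mul_pow, inv_mul_cancel₀ hc0, one_pow,
        one_smul]
  | zero => exact ⟨fun _ => 0, tendsto_const_nhds, fun n => map_zero _⟩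
  | add x y _ _ hx hy =>
    obtain ⟨v, hv, hvx⟩ := hx
    obtain ⟨w, hw, hwy⟩ := hy
    exact ⟨fun n => v n + w n, by simpa using hv.add hw, fun n => by rw [map_add, hvx, hwy]⟩
  | smul a x _ hx =>
    obtain ⟨v, hv, hvx⟩ := hx
    exact ⟨fun n => a • v n, by simpa using hv.const_smul a, fun n => by rw [map_smul, hvx]⟩

/-- A non-constant disc algebra function which takes a unimodular value in the open disc takes
values of modulus less than one and greater than one there. -/
theorem exists_norm_lt_one_and_one_lt {ψ : ℂ → ℂ} (hψ : DiffContOnCl ℂ ψ (ball 0 1))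
    (hconst : ¬ ∃ c : ℂ, ∀ z ∈ closedBall (0 : ℂ) 1, ψ z = c)
    (hD : (ψ '' ball 0 1 ∩ sphere 0 1).Nonempty) :
    (∃ z ∈ ball (0 : ℂ) 1, ‖ψ z‖ < 1) ∧ ∃ z ∈ ball (0 : ℂ) 1, 1 < ‖ψ z‖ := by
  have hopen : IsOpen (ψ '' ball 0 1) := by
    rcases (hψ.differentiableOn.analyticOnNhd isOpen_ball).is_constant_or_isOpen
      (convex_ball 0 1).isPreconnected with ⟨c, hc⟩ | h
    · refine absurd ⟨c, fun z hz => ?_⟩ hconst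
      have hcl : Set.EqOn ψ (fun _ => c) (closure (ball 0 1)) :=
        Set.EqOn.of_subset_closure hc hψ.continuousOn continuousOn_const subset_closure le_rfl
      rw [closure_ball 0 one_ne_zero] at hcl
      exact hcl hz
    · exact h _ subset_rfl isOpen_ball
  obtain ⟨w, hw, hw1⟩ := hD
  rw [mem_sphere_zero_iff_norm] at hw1
  -- The open image contains `t • w` for all real `t` near `1`; one `t` on each side of `1` gives
  -- the two points.
  have hc : Tendsto (fun t : ℝ => (t : ℂ) * w) (𝓝 1) (𝓝 w) := by
    have : Continuous fun t : ℝ => (t : ℂ) * w := by fun_prop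
    simpa using this.tendsto 1
  have hev := hc.eventually (hopen.mem_nhds hw)
  constructor
  · obtain ⟨t, ⟨z, hz, hzt⟩, ht0, ht⟩ := ((hev.filter_mono nhdsWithin_le_nhds).and
      (Ioo_mem_nhdsLT (zero_lt_one (α := ℝ)))).exists
    refine ⟨z, hz, ?_⟩
    rwa [hzt, norm_mul, hw1, mul_one, Complex.norm_real, Real.norm_of_nonneg ht0.le]
  · obtain ⟨t, ⟨z, hz, hzt⟩, ht1, ht⟩ := ((hev.filter_mono nhdsWithin_le_nhds).and
      (Ioo_mem_nhdsGT (one_lt_two (α := ℝ)))).exists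
    refine ⟨z, hz, ?_⟩
    rwa [hzt, norm_mul, hw1, mul_one, Complex.norm_real, Real.norm_of_nonneg (one_pos.trans ht1).le]

/-- Normalized geometric sequences are weakly null as the ratio tends to the unit circle. -/
theorem tendsto_inner_normalized_geom {z : ℕ → ℂ} (hz : ∀ j, ‖z j‖ < 1)
    (hz1 : Tendsto (fun j => ‖z j‖) atTop (𝓝 1)) (f : Ell2 ℕ) :
    Tendsto (fun j => inner ℂ f ((‖geom (z j)‖ : ℂ)⁻¹ • geom (z j))) atTop (𝓝 0) := by
  have hnorm : ∀ j, ‖((‖geom (z j)‖ : ℂ)⁻¹ • geom (z j))‖ = 1 := fun j => by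
    rw [norm_smul, norm_inv, Complex.norm_real, norm_norm,
      inv_mul_cancel₀ (norm_ne_zero_iff.mpr (geom_ne_zero (hz j)))]
  -- The norm of `geom (z j)` is `(1 - |z j|²)^(-1/2)`, which blows up while each coordinate stays
  -- bounded by `1`.
  have hinv : Tendsto (fun j => ‖geom (z j)‖⁻¹) atTop (𝓝 0) := by
    have h1 : Tendsto (fun j => √(1 - ‖z j‖ ^ 2)) atTop (𝓝 0) := by
      have := (Real.continuous_sqrt.tendsto _).comp ((hz1.pow 2).const_sub 1)
      simpa [Function.comp_def] using this
    refine h1.congr fun j => ?_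
    rw [← Real.sqrt_sq (norm_nonneg (geom (z j))), norm_geom_sq (hz j), Real.sqrt_inv, inv_inv]
  refine tendsto_inner_of_dense dense_span_single hnorm (fun g hg => ?_) f
  induction hg using Submodule.span_induction with
  | mem x hx =>
    obtain ⟨i, rfl⟩ := hx
    refine squeeze_zero_norm (fun j => ?_) hinv
    rw [inner_smul_right, lp.inner_single_left, norm_mul, norm_inv, Complex.norm_real, norm_norm,
      geom_apply (hz j)]
    refine mul_le_of_le_one_right (inv_nonneg.mpr (norm_nonneg _)) ?_
    simpa using pow_le_one₀ (norm_nonneg _) (hz j).le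
  | zero => simp
  | add x y _ _ hx hy => simpa only [inner_add_left, add_zero] using hx.add hy
  | smul a x _ hx => simpa only [inner_smul_left, mul_zero] using hx.const_mul (conj a)

/-- A bounded operator on `ℓ²` of which the geometric sequences are eigenvectors, with eigenvalues
given by a suitable disc algebra function, has a hypercyclic subspace. -/
theorem hasHypercyclicSubspace_of_geom {T : Ell2 ℕ →L[ℂ] Ell2 ℕ} {ψ : ℂ → ℂ}
    (hψ : DiffContOnCl ℂ ψ (ball 0 1))
    (hconst : ¬ ∃ c : ℂ, ∀ z ∈ closedBall (0 : ℂ) 1, ψ z = c)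
    (hS : (ψ '' sphere 0 1 ∩ sphere 0 1).Nonempty)
    (hD : (ψ '' ball 0 1 ∩ sphere 0 1).Nonempty)
    (hT : ∀ z ∈ ball (0 : ℂ) 1, T (geom z) = ψ z • geom z) :
    HasHypercyclicSubspace T := by
  obtain ⟨⟨z₁, hz₁, h₁⟩, z₂, hz₂, h₂⟩ := exists_norm_lt_one_and_one_lt hψ hconst hD
  obtain ⟨_, ⟨ζ, hζ, rfl⟩, hl⟩ := hS
  rw [mem_sphere_zero_iff_norm] at hζ hl
  have hcont := hψ.differentiableOn.continuousOn.norm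
  have hU : IsOpen (ball (0 : ℂ) 1 ∩ (fun z => ‖ψ z‖) ⁻¹' Set.Iio 1) :=
    hcont.isOpen_inter_preimage isOpen_ball isOpen_Iio
  have hV : IsOpen (ball (0 : ℂ) 1 ∩ (fun z => ‖ψ z‖) ⁻¹' Set.Ioi 1) :=
    hcont.isOpen_inter_preimage isOpen_ball isOpen_Ioi
  let r : ℕ → ℝ := fun j => 1 - 1 / ((j : ℝ) + 1)
  have hr0 : ∀ j, 0 ≤ r j := fun j => by
    have : 1 / ((j : ℝ) + 1) ≤ 1 := by
      rw [div_le_one (by positivity)]; linarith [j.cast_nonneg (α := ℝ)]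
    simp only [r]; linarith
  have hr1 : ∀ j, r j < 1 := fun j => by
    have : 0 < 1 / ((j : ℝ) + 1) := by positivity
    simp only [r]; linarith
  have hr : Tendsto r atTop (𝓝 1) := by
    simpa [r] using (tendsto_one_div_add_atTop_nhds_zero_nat (𝕜 := ℝ)).const_sub 1
  -- Radial approach to the boundary point `ζ`; continuity of `ψ` on the closed disc gives `ψ (z j)
  -- → ψ ζ`.
  let z : ℕ → ℂ := fun j => (r j : ℂ) * ζ
  have hzn : ∀ j, ‖z j‖ = r j := fun j => by
    rw [norm_mul, hζ, mul_one, Complex.norm_real, Real.norm_of_nonneg (hr0 j)]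
  have hz : ∀ j, ‖z j‖ < 1 := fun j => (hzn j).trans_lt (hr1 j)
  have hzζ : Tendsto z atTop (𝓝 ζ) := by
    simpa using ((Complex.continuous_ofReal.tendsto 1).comp hr).mul_const ζ
  have hψz : Tendsto (fun j => ψ (z j)) atTop (𝓝 (ψ ζ)) := by
    refine Tendsto.comp (hψ.continuousOn_ball ζ (by simp [hζ])) ?_
    exact tendsto_nhdsWithin_iff.mpr ⟨hzζ, Eventually.of_forall fun j => by simpa using (hz j).le⟩
  have hnorm : ∀ j, ‖((‖geom (z j)‖ : ℂ)⁻¹ • geom (z j))‖ = 1 := fun j => by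
    rw [norm_smul, norm_inv, Complex.norm_real, norm_norm,
      inv_mul_cancel₀ (norm_ne_zero_iff.mpr (geom_ne_zero (hz j)))]
  refine hasHypercyclicSubspace_of_criterion T
    (dense_span_geom hU ⟨z₁, hz₁, h₁⟩ Set.inter_subset_left) ?_
    (dense_span_geom hV ⟨z₂, hz₂, h₂⟩ Set.inter_subset_left) ?_ hl
    (v := fun j => (‖geom (z j)‖ : ℂ)⁻¹ • geom (z j)) hnorm
    (tendsto_inner_normalized_geom hz (by simpa [hzn] using hr)) ?_
  · refine fun y hy => tendsto_pow_of_mem_span ?_ hy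
    rintro _ ⟨z, hz, rfl⟩
    exact ⟨ψ z, hz.2, hT z hz.1⟩
  · refine fun y hy => exists_backward_orbit_of_mem_span ?_ hy
    rintro _ ⟨z, hz, rfl⟩
    exact ⟨ψ z, hz.2, hT z hz.1⟩
  · have h0 : Tendsto (fun j => ‖ψ (z j) - ψ ζ‖) atTop (𝓝 0) := by
      simpa using (hψz.sub_const (ψ ζ)).norm
    refine squeeze_zero_norm (fun j => le_of_eq ?_) h0
    rw [map_smul, hT _ (by simpa using hz j), smul_comm, ← sub_smul, norm_smul, hnorm, mul_one]

/-! ### Eigenvectors of `φ(S*)` and transfer along isomorphisms -/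

theorem backwardShift_geom {z : ℂ} (hz : ‖z‖ < 1) : backwardShift (geom z) = z • geom z := by
  refine lp.ext (funext fun n => ?_)
  rw [backwardShift_apply, geom_apply hz, pow_succ']
  simp [geom_apply hz]

theorem aeval_apply_of_eigen {X : Type*} [NormedAddCommGroup X] [NormedSpace ℂ X] {T : X →L[ℂ] X}
    {x : X} {c : ℂ} (h : T x = c • x) (P : ℂ[X]) : aeval T P x = P.eval c • x := by
  induction P using Polynomial.induction_on' with
  | add p q hp hq => rw [map_add, add_apply, hp, hq, eval_add, add_smul]
  | monomial n a =>
    rw [aeval_monomial, mul_apply_eq_comp, pow_apply_of_eigen h, eval_monomial, map_smul, mul_comm,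
      mul_smul, Algebra.algebraMap_eq_smul_one]
    rfl

theorem phiBackwardShift_geom {φ : ℂ → ℂ} (hφ : DiffContOnCl ℂ φ (ball 0 1)) {z : ℂ}
    (hz : ‖z‖ < 1) : phiBackwardShift φ hφ (geom z) = φ z • geom z := by
  obtain ⟨P, hP⟩ := exists_polynomial_seq hφ
  have h1 : Tendsto (fun n => aeval backwardShift (P n) (geom z)) atTop
      (𝓝 (phiBackwardShift φ hφ (geom z))) :=
    ((ContinuousLinearMap.apply ℂ (Ell2 ℕ) (geom z)).continuous.tendsto _).comp
      (tendsto_phiBackwardShift hφ hP)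
  have h2 : Tendsto (fun n => aeval backwardShift (P n) (geom z)) atTop (𝓝 (φ z • geom z)) := by
    simp only [aeval_apply_of_eigen (backwardShift_geom hz)]
    exact (hP.tendsto_at (by simpa using hz.le)).smul_const _
  exact tendsto_nhds_unique h1 h2

/-- Having a hypercyclic subspace is invariant under isometric isomorphism. -/
theorem HasHypercyclicSubspace.of_conj {X Y : Type*} [NormedAddCommGroup X] [NormedSpace ℂ X]
    [NormedAddCommGroup Y] [NormedSpace ℂ Y] (J : X ≃L[ℂ] Y) {T : X →L[ℂ] X} {S : Y →L[ℂ] Y}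
    (hJ : ∀ x, S (J x) = J (T x)) (hT : HasHypercyclicSubspace T) : HasHypercyclicSubspace S := by
  obtain ⟨M, hM, hinf, hyp⟩ := hT
  have hpow : ∀ (n : ℕ) x, (S ^ n) (J x) = J ((T ^ n) x) := by
    intro n
    induction n with
    | zero => intro x; rfl
    | succ n ih => intro x; rw [pow_succ, pow_succ, mul_apply_eq_comp, mul_apply_eq_comp, hJ, ih]
  refine ⟨M.map (J : X →ₗ[ℂ] Y), ?_, fun h => hinf ?_, ?_⟩
  · rw [Submodule.map_coe]
    exact J.toHomeomorph.isClosedMap _ hM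
  · exact (J.toLinearEquiv.submoduleMap M).symm.finiteDimensional
  · rintro _ ⟨x, hx, rfl⟩ hne
    have h := hyp x hx fun h => hne (by simp [h])
    have h2 := J.surjective.denseRange.dense_image J.continuous h
    rw [← Set.range_comp] at h2
    have h3 : (fun n : ℕ => (S ^ n) (J x)) = J ∘ fun n : ℕ => (T ^ n) x := funext fun n => hpow n x
    change Dense (Set.range fun n : ℕ => (S ^ n) (J x))
    rwa [h3]

/-! ### The coanalytic Toeplitz operator in the monomial basis of the Hardy space -/

/-- The monomials `zⁿ`, `n ≥ 0`, in the Hardy space. -/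
def hardyMonomial (n : ℕ) : hardySpace :=
  ⟨fourierLp 2 (n : ℤ), by
    rw [mem_hardySpace]
    intro m hm
    rw [← fourierBasis_repr, HilbertBasis.repr_apply_apply, coe_fourierBasis,
      orthonormal_fourier.2]
    omega⟩

theorem orthonormal_hardyMonomial : Orthonormal ℂ hardyMonomial :=
  ⟨fun n => orthonormal_fourier.1 n, fun _ _ h =>
    orthonormal_fourier.2 fun h' => h (Nat.cast_injective h')⟩

/-- Membership in `H²` kills the negative Fourier coefficients and orthogonality to the monomials
kills the others. -/
theorem orthogonal_span_hardyMonomial :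
    (Submodule.span ℂ (Set.range hardyMonomial))ᗮ = ⊥ := by
  refine (Submodule.eq_bot_iff _).mpr fun f hf => ?_
  have h : ∀ n : ℤ, fourierBasis.repr (f : L2Circle) n = 0 := by
    intro n
    rcases lt_or_ge n 0 with hn | hn
    · rw [fourierBasis_repr]
      exact mem_hardySpace.mp f.2 n hn
    · lift n to ℕ using hn
      rw [HilbertBasis.repr_apply_apply, coe_fourierBasis]
      exact (Submodule.mem_orthogonal _ f).mp hf _ (Submodule.subset_span ⟨n, rfl⟩)
  have h1 : fourierBasis.repr (f : L2Circle) = 0 := lp.ext (funext h)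
  exact Subtype.ext ((LinearIsometryEquiv.map_eq_zero_iff _).mp h1)

/-- The Hilbert basis of monomials of the Hardy space. -/
def hardyBasis : HilbertBasis ℕ ℂ hardySpace :=
  HilbertBasis.mkOfOrthogonalEqBot orthonormal_hardyMonomial orthogonal_span_hardyMonomial

theorem coe_hardyBasis : ⇑hardyBasis = hardyMonomial :=
  HilbertBasis.coe_mkOfOrthogonalEqBot _ _

/-- Multiplication of `L²` functions on the circle by continuous functions. -/
def mulCircle : C(UnitAddCircle, ℂ) →L[ℂ] L2Circle →L[ℂ] L2Circle :=
  ((ContinuousLinearMap.mul ℂ ℂ).holderL AddCircle.haarAddCircle ∞ 2 2) ∘L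
    ContinuousMap.toLp ∞ AddCircle.haarAddCircle ℂ

theorem mulCircle_fourier (m n : ℤ) :
    mulCircle (fourier m) (fourierLp 2 n) = fourierLp 2 (m + n) := by
  refine Lp.ext ?_
  have h1 := (ContinuousLinearMap.mul ℂ ℂ).coeFn_holder (r := 2)
    (ContinuousMap.toLp (E := ℂ) ∞ AddCircle.haarAddCircle ℂ (fourier (T := (1 : ℝ)) m))
    (fourierLp (T := (1 : ℝ)) 2 n)
  have h2 := ContinuousMap.coeFn_toLp (p := ∞) (𝕜 := ℂ) AddCircle.haarAddCircle
    (fourier (T := (1 : ℝ)) m)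
  refine h1.trans ?_
  filter_upwards [h2, coeFn_fourierLp (T := (1 : ℝ)) 2 n, coeFn_fourierLp (T := (1 : ℝ)) 2 (m + n)]
    with t a b c
  rw [a, b, c, fourier_add, ContinuousLinearMap.mul_apply']

/-- The conjugate of the boundary function of a disc algebra function. -/
def conjBoundary (φ : ℂ → ℂ) (hφ : ContinuousOn φ (closedBall 0 1)) : C(UnitAddCircle, ℂ) where
  toFun t := conj (φ (AddCircle.toCircle t))
  continuous_toFun := by
    refine Complex.continuous_conj.comp (hφ.comp_continuous ?_ fun t => ?_)
    · exact continuous_subtype_val.comp AddCircle.continuous_toCircle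
    · rw [mem_closedBall_zero_iff, Circle.norm_coe]

/-- On the circle, the conjugate of `z ^ j` is `z ^ (-j)`. -/
theorem conjBoundary_polynomial (P : ℂ[X]) :
    conjBoundary P.eval P.continuous.continuousOn =
      ∑ j ∈ Finset.range (P.natDegree + 1), conj (P.coeff j) • fourier (-(j : ℤ)) := by
  ext t
  simp only [conjBoundary, ContinuousMap.coe_mk, eval_eq_sum_range, map_sum, map_mul, map_pow,
    ContinuousMap.coe_sum, Finset.sum_apply, ContinuousMap.coe_smul, Pi.smul_apply, smul_eq_mul,
    fourier_neg]
  refine Finset.sum_congr rfl fun j _ => ?_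
  simp [fourier_apply, AddCircle.toCircle_nsmul]

/-- Replaces the `L^∞` symbol by a continuous one, on which multiplication depends linearly and
continuously, so that the symbol can be approximated. -/
theorem coanalyticToeplitz_apply {φ : ℂ → ℂ} (hφ : DiffContOnCl ℂ φ (ball 0 1)) (f : hardySpace) :
    coanalyticToeplitz φ hφ f =
      hardySpace.orthogonalProjectionOnto (mulCircle (conjBoundary φ hφ.continuousOn_ball) f) := rfl

theorem hasSum_hardyBasis_geom {w : ℂ} (hw : ‖w‖ < 1) :
    HasSum (fun n : ℕ => w ^ n • (fourierLp 2 (n : ℤ) : L2Circle))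
      (hardyBasis.repr.symm (geom w) : L2Circle) := by
  have h := hardySpace.subtypeL.hasSum (hardyBasis.hasSum_repr_symm (geom w))
  simpa [Function.comp_def, geom_apply hw, coe_hardyBasis, hardyMonomial] using h

/-- Multiplication by `z ^ (-j)` sends `z ^ n` to `z ^ (n - j)`, so only `n = m + j` contributes to
the coefficient of `z ^ m`. -/
theorem inner_mulCircle_fourier_geom {w : ℂ} (hw : ‖w‖ < 1) (m j : ℕ) :
    inner ℂ (fourierLp 2 (m : ℤ) : L2Circle)
      (mulCircle (fourier (-(j : ℤ))) (hardyBasis.repr.symm (geom w))) = w ^ (m + j) := by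
  let Q : L2Circle →L[ℂ] ℂ := (innerSL ℂ (fourierLp 2 (m : ℤ))) ∘L mulCircle (fourier (-(j : ℤ)))
  have h := Q.hasSum (hasSum_hardyBasis_geom hw)
  have hQ : ∀ n : ℕ, Q (w ^ n • (fourierLp 2 (n : ℤ))) = if n = m + j then w ^ (m + j) else 0 := by
    intro n
    simp only [Q, map_smul, ContinuousLinearMap.comp_apply, mulCircle_fourier, innerSL_apply_apply,
      smul_eq_mul, orthonormal_iff_ite.mp orthonormal_fourier]
    by_cases hn : n = m + j
    · rw [if_pos hn, if_pos (by omega), hn, mul_one]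
    · rw [if_neg hn, if_neg (by omega), mul_zero]
  have h1 := hasSum_ite_eq (m + j) (w ^ (m + j))
  rw [← funext hQ] at h1
  exact h.unique h1

/-- For a polynomial with coefficients `p j` the coefficient is `∑ conj (p j) * w ^ (m + j)`. Both
sides are continuous under uniform convergence of the symbol on the closed disc, which gives the
general case. -/
theorem inner_mulCircle_conjBoundary_geom {φ : ℂ → ℂ} (hφ : DiffContOnCl ℂ φ (ball 0 1)) {w : ℂ}
    (hw : ‖w‖ < 1) (m : ℕ) :
    inner ℂ (fourierLp 2 (m : ℤ) : L2Circle)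
      (mulCircle (conjBoundary φ hφ.continuousOn_ball) (hardyBasis.repr.symm (geom w))) =
      conj (φ (conj w)) * w ^ m := by
  let Q : C(UnitAddCircle, ℂ) →L[ℂ] ℂ := (innerSL ℂ (fourierLp 2 (m : ℤ) : L2Circle)) ∘L
    (ContinuousLinearMap.apply ℂ L2Circle (hardyBasis.repr.symm (geom w) : L2Circle)) ∘L mulCircle
  have hQ : ∀ P : ℂ[X], Q (conjBoundary P.eval P.continuous.continuousOn) =
      conj (P.eval (conj w)) * w ^ m := by
    intro P
    have h1 : ∀ j : ℕ, Q (fourier (-(j : ℤ))) = w ^ (m + j) :=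
      inner_mulCircle_fourier_geom hw m
    rw [conjBoundary_polynomial, map_sum, eval_eq_sum_range, map_sum, Finset.sum_mul]
    refine Finset.sum_congr rfl fun j _ => ?_
    rw [map_smul, h1, map_mul, map_pow, Complex.conj_conj, smul_eq_mul, pow_add]
    ring
  obtain ⟨P, hP⟩ := exists_polynomial_seq hφ
  have hlim : Tendsto (fun n => conjBoundary (P n).eval (P n).continuous.continuousOn) atTop
      (𝓝 (conjBoundary φ hφ.continuousOn_ball)) := by
    rw [ContinuousMap.tendsto_iff_tendstoUniformly, Metric.tendstoUniformly_iff]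
    intro ε hε
    filter_upwards [Metric.tendstoUniformlyOn_iff.mp hP ε hε] with n hn t
    have := hn (AddCircle.toCircle t) (by rw [mem_closedBall_zero_iff, Circle.norm_coe])
    simpa [conjBoundary, Complex.dist_conj_conj] using this
  refine tendsto_nhds_unique ((Q.continuous.tendsto _).comp hlim) ?_
  simp only [Function.comp_def, hQ]
  have hw1 : conj w ∈ closedBall (0 : ℂ) 1 := by simpa using hw.le
  exact ((Complex.continuous_conj.tendsto _).comp (hP.tendsto_at hw1)).mul_const _

/-- The projection `P₊` does not change inner products with `z ^ m`, `m ≥ 0`, so the coefficients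
are those computed before projecting. -/
theorem coanalyticToeplitz_geom {φ : ℂ → ℂ} (hφ : DiffContOnCl ℂ φ (ball 0 1)) {w : ℂ}
    (hw : ‖w‖ < 1) :
    coanalyticToeplitz φ hφ (hardyBasis.repr.symm (geom w)) =
      conj (φ (conj w)) • hardyBasis.repr.symm (geom w) := by
  refine hardyBasis.repr.injective (lp.ext (funext fun m => ?_))
  rw [map_smul, LinearIsometryEquiv.apply_symm_apply, HilbertBasis.repr_apply_apply,
    coanalyticToeplitz_apply, Submodule.inner_orthogonalProjectionOnto_eq_of_mem_left,
    coe_hardyBasis]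
  refine (inner_mulCircle_conjBoundary_geom hφ hw m).trans ?_
  rw [← geom_apply hw]
  rfl

theorem diffContOnCl_conj_conj {φ : ℂ → ℂ} (hφ : DiffContOnCl ℂ φ (ball 0 1)) :
    DiffContOnCl ℂ (fun z => conj (φ (conj z))) (ball 0 1) := by
  refine DiffContOnCl.mk_ball (fun z hz => ?_) ?_
  · have h := (hφ.differentiableAt isOpen_ball (x := conj z) (by simpa using hz)).conj_conj
    rw [Complex.conj_conj] at h
    exact h.differentiableWithinAt
  · refine Complex.continuous_conj.comp_continuousOn (hφ.continuousOn_ball.comp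
      Complex.continuous_conj.continuousOn fun z hz => ?_)
    simpa using hz

theorem nonempty_image_conj_conj {φ : ℂ → ℂ} {S : Set ℂ} (hS : ∀ z ∈ S, conj z ∈ S)
    (h : (φ '' S ∩ sphere 0 1).Nonempty) :
    ((fun z => conj (φ (conj z))) '' S ∩ sphere 0 1).Nonempty := by
  obtain ⟨_, ⟨z, hz, rfl⟩, h⟩ := h
  exact ⟨_, ⟨conj z, hS z hz, rfl⟩, by simpa using h⟩

end HypSub

end

/-! ### Conclusion for both operators -/

theorem mainTheorem1 (φ : ℂ → ℂ) (hφ : DiffContOnCl ℂ φ (Metric.ball 0 1))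
    (hconst : ¬ ∃ c : ℂ, ∀ z ∈ Metric.closedBall (0 : ℂ) 1, φ z = c)
    (hT : (φ '' Metric.sphere 0 1 ∩ Metric.sphere 0 1).Nonempty)
    (hD : (φ '' Metric.ball 0 1 ∩ Metric.sphere 0 1).Nonempty) :
    HypSub.HasHypercyclicSubspace (HypSub.phiBackwardShift φ hφ) ∧
      HypSub.HasHypercyclicSubspace (HypSub.coanalyticToeplitz φ hφ) := by
  refine ⟨HypSub.hasHypercyclicSubspace_of_geom hφ hconst hT hD fun z hz =>
    HypSub.phiBackwardShift_geom hφ (by simpa using hz), ?_⟩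
  let J : HypSub.Ell2 ℕ ≃L[ℂ] HypSub.hardySpace :=
    HypSub.hardyBasis.repr.symm.toContinuousLinearEquiv
  -- The Toeplitz operator transported to `ℓ²`; its eigenvalue at `geom z` is `conj (φ (conj z))`.
  let S : HypSub.Ell2 ℕ →L[ℂ] HypSub.Ell2 ℕ :=
    (J.symm : HypSub.hardySpace →L[ℂ] HypSub.Ell2 ℕ) ∘L HypSub.coanalyticToeplitz φ hφ ∘L
      (J : HypSub.Ell2 ℕ →L[ℂ] HypSub.hardySpace)
  refine HypSub.HasHypercyclicSubspace.of_conj J (T := S) (fun x => (J.apply_symm_apply _).symm) ?_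
  refine HypSub.hasHypercyclicSubspace_of_geom (HypSub.diffContOnCl_conj_conj hφ) ?_
    (HypSub.nonempty_image_conj_conj (fun z hz => by simpa using hz) hT)
    (HypSub.nonempty_image_conj_conj (fun z hz => by simpa using hz) hD) fun z hz => ?_
  · rintro ⟨c, hc⟩
    refine hconst ⟨conj c, fun z hz => ?_⟩
    have := hc (conj z) (by simpa using hz)
    rw [← this, Complex.conj_conj, Complex.conj_conj]
  · have h := HypSub.coanalyticToeplitz_geom hφ (w := z) (by simpa using hz)
    change J.symm (HypSub.coanalyticToeplitz φ hφ (HypSub.hardyBasis.repr.symm (HypSub.geom z))) = _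
    rw [h, map_smul]
    congr 1
    exact J.symm_apply_apply _
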